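/- All series below are formal power series in $q$, and $(z;q)_n=\prod_{j=0}^{n-1}(1-zq^j)$. For integers $0\le i\le d$ with $d\ge 1$, a *2-cylindric partition of profile* $\Lambda=[d-i,i]$ is an array of non-negative integers, only finitely many of them non-zero, consisting of a first row $(\pi_{1,j})_{j>i}$ and a second row $(\pi_{2,j})_{j>0}$, such that both rows are weakly decreasing in $j$, $\pi_{1,j}\ge\pi_{2,j}$ for all $j>i$, and $\pi_{2,j}\ge\pi_{1,j+d}$ for all $j>0$ with $j+d>i$. Its norm $|\pi|$ is the sum of its entries. For $a\ge0$ let $\mathrm{CP}_\Lambda(a)=\sum_\pi q^{|\pi|}$, summed over all 2-cylindric partitions $\pi$ of profile $\Lambda$ whose entries do not exceed $a$. For $k\ge1$ let $\mathcal P_k$ be the set of partitions $\lambda=(\lambda_1\ge\lambda_2\ge\cdots\ge\lambda_k\ge0)$ with at most $k$ parts. For $a\ge0$, $f\ge1$ and $\lambda\in\mathcal P_k$ set $$\begin{bmatrix}a\\ \lambda\end{bmatrix}^{(f)}=\frac{(q^f;q^f)_a}{(q;q)_{a-\lambda_1}(q;q)_{\lambda_1-\lambda_2}\cdots(q;q)_{\lambda_{k-1}-\lambda_k}\,(q^f;q^f)_{\lambda_k}}\quad\text{if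 }\lambda_1\le a,$$ and $\begin{bmatrix}a\\ \lambda\end{bmatrix}^{(f)}=0$ if $\lambda_1>a$. **Theorem.** Let $d\ge2$, $k=\lfloor d/2\rfloor$, $0\le i\le k$, $\Lambda=[d-i,i]$ and $a\ge0$. If $d$ is odd, then $$\mathrm{CP}_\Lambda(a)=\frac1{(q;q)_a}\sum_{\lambda\in\mathcal P_k}q^{\lambda_1^2+\cdots+\lambda_k^2+\lambda_{i+1}+\cdots+\lambda_k}\begin{bmatrix}a\\ \lambda\end{bmatrix}^{(1)},$$ and if $d$ is even, then $$\mathrm{CP}_\Lambda(a)=\frac1{(q^2;q^2)_a}\sum_{\lambda\in\mathcal P_k}q^{\lambda_1^2+\cdots+\lambda_k^2+\lambda_{i+1}+\cdots+\lambda_k}\begin{bmatrix}a\\ \lambda\end{bmatrix}^{(2)}.$$ -/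

import Mathlib

open PowerSeries

/-- The partition `μ = λ̂(Λ)` attached to the weight `Λ = [m 0, …, m (r-1)]`. The row with
(zero-based) index `i` is shifted by the sum of the `m l` with `l > i`; in particular the last
row is not shifted. -/
def weightShift {r : ℕ} (m : Fin r → ℕ) (i : Fin r) : ℕ :=
  ∑ l ∈ Finset.univ.filter (fun l => i < l), m l

/-- `IsCylindricPartition d μ π`: the array `π` with finitely many non-zero entries is a
cylindric partition of type `(∞^r)/μ/d`. Row `i` consists of the entries `π (i, j)` with
`j > μ i`; positions `j ≤ μ i`, which do not belong to the array, carry the filler value `0`,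
and no condition involves them otherwise. -/
structure IsCylindricPartition {r : ℕ} (d : ℕ) (μ : Fin r → ℕ) (π : Fin r × ℕ →₀ ℕ) : Prop where
  /-- filler outside of the array -/
  outside : ∀ i j, j ≤ μ i → π (i, j) = 0
  /-- weakly decreasing along the rows -/
  row : ∀ i j, μ i < j → π (i, j + 1) ≤ π (i, j)
  /-- weakly decreasing down the columns -/
  column : ∀ i i' : Fin r, (i' : ℕ) = i + 1 → ∀ j, μ i < j → μ i' < j → π (i', j) ≤ π (i, j)
  /-- the last row dominates the copy of the first row displaced `d` positions to the left -/
  cylindric : ∀ first last : Fin r, (first : ℕ) = 0 → (last : ℕ) + 1 = r →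
    ∀ j, μ last < j → μ first < j + d → π (first, j + d) ≤ π (last, j)

/-- The cylindric partitions of profile `Λ = [m 0, …, m (r-1)]` (of level `d = ∑ m l`) with
finitely many non-zero entries, all of whose entries are at most `a`. -/
def cylindricPartitions {r : ℕ} (m : Fin r → ℕ) (a : ℕ) : Set (Fin r × ℕ →₀ ℕ) :=
  {π | IsCylindricPartition (∑ l, m l) (weightShift m) π ∧ ∀ p, π p ≤ a}

/-- The norm `|π|`: the sum of the entries. -/
def arrayNorm {r : ℕ} (π : Fin r × ℕ →₀ ℕ) : ℕ := π.sum fun _ x => x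

/-- The generating function `∑ q^|π|` over `cylindricPartitions m a`, as a formal power series:
its `n`-th coefficient counts those `π` of norm `n` (a finite set, see
`cylindricPartitions_norm_finite`). -/
noncomputable def cylindricGenFun {r : ℕ} (m : Fin r → ℕ) (a : ℕ) : ℚ⟦X⟧ :=
  PowerSeries.mk fun n => (({π ∈ cylindricPartitions m a | arrayNorm π = n}.ncard : ℕ) : ℚ)

/-- There are finitely many cylindric partitions of given profile and norm, so that the
coefficients of `cylindricGenFun` are honest cardinalities. -/
theorem cylindricPartitions_norm_finite {r : ℕ} (m : Fin r → ℕ) (a n : ℕ) :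
    {π ∈ cylindricPartitions m a | arrayNorm π = n}.Finite := by
  classical
  let S : Finset (Fin r × ℕ) :=
    Finset.univ.biUnion fun i : Fin r =>
      (Finset.range (weightShift m i + n + 1)).image fun j => (i, j)
  refine Set.Finite.subset (Finset.finite_toSet (Finset.finsupp S fun _ => Finset.range (a + 1))) ?_
  rintro π ⟨⟨h, ha⟩, hn⟩
  rw [Finset.mem_coe, Finset.mem_finsupp_iff]
  refine ⟨?_, fun p _ => Finset.mem_range.2 (Nat.lt_succ_of_le (ha p))⟩
  rintro ⟨i, j⟩ hj
  simp only [S, Finset.mem_biUnion, Finset.mem_univ, true_and, Finset.mem_image, Finset.mem_range]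
  refine ⟨i, j, ?_, rfl⟩
  by_contra hlt
  have hpos : ∀ t, ∀ l, weightShift m i < l → l + t = j → 0 < π (i, l) := by
    intro t
    induction t with
    | zero =>
      intro l _ hl
      rw [show l = j by omega]
      exact Nat.pos_of_ne_zero (Finsupp.mem_support_iff.1 hj)
    | succ t ih =>
      intro l h1 hl
      exact lt_of_lt_of_le (ih (l + 1) (by omega) (by omega)) (h.row i l h1)
  let T : Finset (Fin r × ℕ) :=
    (Finset.Icc (weightShift m i + 1) j).image fun l => (i, l)
  have hT : T ⊆ π.support := by
    intro p hp
    obtain ⟨l, hl, rfl⟩ := Finset.mem_image.1 hp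
    rw [Finset.mem_Icc] at hl
    exact Finsupp.mem_support_iff.2 (hpos (j - l) l (by omega) (by omega)).ne'
  have hcard : T.card = j - weightShift m i := by
    rw [Finset.card_image_of_injective _ (fun x y hxy => (Prod.mk.inj hxy).2), Nat.card_Icc]
    omega
  have h1 : π.support.card ≤ n := by
    rw [← hn, arrayNorm, Finsupp.sum, Finset.card_eq_sum_ones]
    exact Finset.sum_le_sum fun p hp => Nat.pos_of_ne_zero (Finsupp.mem_support_iff.1 hp)
  have h2 := Finset.card_le_card hT
  omega

/-- The set `P_k` of partitions with at most `k` parts: weakly decreasing sequences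
`(p 0, p 1, …)` (so `p j` is the part `λ_{j+1}`) that vanish from index `k` on. -/
def PartitionsAtMost (k : ℕ) : Type :=
  {p : ℕ → ℕ // Antitone p ∧ ∀ j, k ≤ j → p j = 0}

/-- The Pochhammer symbol `(z; q)_n = ∏_{i<n} (1 - z q^i)`. -/
noncomputable def pochhammerQ (z q : ℚ⟦X⟧) (n : ℕ) : ℚ⟦X⟧ :=
  ∏ i ∈ Finset.range n, (1 - z * q ^ i)

/-- The generalised `q`-multinomial `[a; λ]^{(f)}` for `λ ∈ P_k`, `k ≥ 1`:
`(q^f;q^f)_a / ((q;q)_{a-λ_1} (q;q)_{λ_1-λ_2} ⋯ (q;q)_{λ_{k-1}-λ_k} (q^f;q^f)_{λ_k})`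
if `λ_1 ≤ a`, and `0` otherwise. All Pochhammer symbols in the denominator have constant term `1`
for `f ≥ 1`, hence are invertible. -/
noncomputable def qMultinomial (f a : ℕ) {k : ℕ} (p : PartitionsAtMost k) : ℚ⟦X⟧ :=
  if p.1 0 ≤ a then
    pochhammerQ (X ^ f) (X ^ f) a *
      (pochhammerQ X X (a - p.1 0) *
        (∏ j ∈ Finset.range (k - 1), pochhammerQ X X (p.1 j - p.1 (j + 1))) *
        pochhammerQ (X ^ f) (X ^ f) (p.1 (k - 1)))⁻¹
  else 0

/-- The exponent `λ_1^2 + ⋯ + λ_k^2 + λ_{i+1} + ⋯ + λ_k`. -/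
def agbExponent (i : ℕ) {k : ℕ} (p : PartitionsAtMost k) : ℕ :=
  ∑ j ∈ Finset.range k, p.1 j ^ 2 + ∑ j ∈ Finset.Ico i k, p.1 j

/-- The sum over `λ ∈ P_k` of `q^{λ_1^2 + ⋯ + λ_k^2 + λ_{i+1} + ⋯ + λ_k} [a; λ]^{(f)}`.
Only finitely many summands are non-zero, see `agbSummand_support_finite`. -/
noncomputable def agbSum (f a i k : ℕ) : ℚ⟦X⟧ :=
  ∑ᶠ p : PartitionsAtMost k, X ^ agbExponent i p * qMultinomial f a p

/-- The sum defining `agbSum` has finite support. -/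
theorem agbSummand_support_finite (f a i k : ℕ) :
    (Function.support fun p : PartitionsAtMost k =>
      (X : ℚ⟦X⟧) ^ agbExponent i p * qMultinomial f a p).Finite := by
  have hinj : Set.InjOn (fun (p : PartitionsAtMost k) (j : Fin k) => p.1 j)
      (Function.support fun p : PartitionsAtMost k =>
        (X : ℚ⟦X⟧) ^ agbExponent i p * qMultinomial f a p) := by
    intro p _ p' _ h
    apply Subtype.ext
    funext j
    by_cases hj : j < k
    · exact congrFun h ⟨j, hj⟩
    · rw [p.2.2 j (by omega), p'.2.2 j (by omega)]
  refine Set.Finite.of_finite_image ?_ hinj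
  refine (Set.finite_Iic (fun _ : Fin k => a)).subset ?_
  rintro _ ⟨p, hp, rfl⟩ j
  by_contra hlt
  have h0 : ¬ p.1 0 ≤ a := fun h => hlt ((p.2.1 (Nat.zero_le _)).trans h)
  exact hp (by simp [qMultinomial, h0])

/-!
Fix the level `d` and write `G a s` for the generating function of cylindric partitions of profile
`[d - s, s]` with entries at most `a`. Such a partition either has all entries at most `a - 1`, or
its first row or its second row starts with `a`. Removing a leading `a` from the first row leads to
the profile `s + 1`, removing it from the second row leads to `s - 1`, and removing both leads back
to `s`, so that inclusion–exclusion gives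
`(1 + q^{2a}) G a s - q^a (G a (s - 1) + G a (s + 1)) = G (a - 1) s`,
with the conventions `G a (-1) = q^a G a 0` and `G a (d + 1) = q^a G a d` at the ends of the row
(`cylindricRecurrence_cylindricGenFun`). Together with `G 0 s = 1` this determines `G`
(`CylindricRecurrence.unique`), because the linear system for row `a` is invertible modulo `q`.

The sums on the other side satisfy the same system. The transform
`H a = ∑_{n ≤ a} q^{n²} / (q; q)_{a - n} g n` carries a solution `g` at level `d`, continued by
its two boundary values, to a solution at level `d + 2` (`CylindricRecurrence.baileyTransform`).
At the levels `0` and `1` the solutions are `1 / (q²; q²)_n` and `1 / (q; q)_n`, constant in `s`.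
After `k` transforms one has the `k`-fold sum over `λ_1 ≥ ⋯ ≥ λ_k`
(`exists_cylindricRecurrence_multisum`). Each transform moves the position in the row by one towards
its end, and once the end is reached every further step contributes a boundary factor `q^n`; this
is the origin of the linear terms `λ_{i+1} + ⋯ + λ_k` in the exponent.
-/

/-! ### The recurrence and the uniqueness of its solution -/

/-- The row of values `h 0, …, h d` is continued by one value on each side and shifted:
index `s + 1` carries `h s` for `s ≤ d`, while index `0` and the indices beyond `d + 1` carry the
boundary values `q ^ n * h 0` and `q ^ n * h d`. -/
noncomputable def boundaryExtension (d n : ℕ) (h : ℕ → ℚ⟦X⟧) : ℕ → ℚ⟦X⟧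
  | 0 => X ^ n * h 0
  | s + 1 => if s ≤ d then h s else X ^ n * h d

/-- The system satisfied by the generating functions `g a s` of cylindric partitions of profile
`[d - s, s]` with entries at most `a`: a three-term relation in `s` for each `a`, with the
boundary conditions `g a (-1) = q ^ a * g a 0` and `g a (d + 1) = q ^ a * g a d` built into
`boundaryExtension`. -/
structure CylindricRecurrence (d : ℕ) (g : ℕ → ℕ → ℚ⟦X⟧) : Prop where
  /-- the initial values -/
  zero : ∀ s ≤ d, g 0 s = 1
  /-- the three-term relation -/
  succ : ∀ n, ∀ s ≤ d, (1 + X ^ (2 * (n + 1))) * g (n + 1) s -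
    X ^ (n + 1) * (boundaryExtension d (n + 1) (g (n + 1)) s +
      boundaryExtension d (n + 1) (g (n + 1)) (s + 2)) = g n s

theorem boundaryExtension_succ {d s : ℕ} (hs : s ≤ d) (n : ℕ) (h : ℕ → ℚ⟦X⟧) :
    boundaryExtension d n h (s + 1) = h s := by
  simp [boundaryExtension, hs]

theorem boundaryExtension_last (d n : ℕ) (h : ℕ → ℚ⟦X⟧) :
    boundaryExtension d n h (d + 2) = X ^ n * h d := by
  simp [boundaryExtension]

theorem boundaryExtension_sub (d n : ℕ) (h h' : ℕ → ℚ⟦X⟧) (s : ℕ) :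
    boundaryExtension d n (fun s => h s - h' s) s =
      boundaryExtension d n h s - boundaryExtension d n h' s := by
  cases s with
  | zero => simp only [boundaryExtension]; ring
  | succ s => simp only [boundaryExtension]; split_ifs <;> ring

theorem dvd_boundaryExtension {d : ℕ} {h : ℕ → ℚ⟦X⟧} {c : ℚ⟦X⟧} (hc : ∀ s ≤ d, c ∣ h s)
    (n s : ℕ) : c ∣ boundaryExtension d n h s := by
  cases s with
  | zero => exact (hc 0 (Nat.zero_le d)).mul_left _
  | succ s =>
    simp only [boundaryExtension]
    split_ifs with hs
    · exact hc s hs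
    · exact (hc d le_rfl).mul_left _

theorem eq_zero_of_forall_X_pow_dvd {φ : ℚ⟦X⟧} (h : ∀ m : ℕ, X ^ m ∣ φ) : φ = 0 := by
  ext n
  exact X_pow_dvd_iff.1 (h (n + 1)) n n.lt_succ_self

/-- For `n ≥ 1` the three-term relation reads `h = q * (…)` up to a unit, so that a row solving
the homogeneous relation is divisible by every power of `q`. -/
theorem CylindricRecurrence.unique {d : ℕ} {g g' : ℕ → ℕ → ℚ⟦X⟧}
    (hg : CylindricRecurrence d g) (hg' : CylindricRecurrence d g') (n : ℕ) :
    ∀ s ≤ d, g n s = g' n s := by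
  induction n with
  | zero => intro s hs; rw [hg.zero s hs, hg'.zero s hs]
  | succ n ih =>
    have key : ∀ m : ℕ, ∀ s ≤ d, X ^ m ∣ g (n + 1) s - g' (n + 1) s := by
      intro m
      induction m with
      | zero => intro s _; simp
      | succ m ihm =>
        intro s hs
        have hext := dvd_boundaryExtension (d := d) (h := fun s => g (n + 1) s - g' (n + 1) s)
          ihm (n + 1)
        have hunit : IsUnit (1 + X ^ (2 * (n + 1)) : ℚ⟦X⟧) := by
          rw [PowerSeries.isUnit_iff_constantCoeff]
          simp
        rw [← hunit.dvd_mul_left]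
        have h1 := hg.succ n s hs
        have h2 := hg'.succ n s hs
        have heq : (1 + X ^ (2 * (n + 1))) * (g (n + 1) s - g' (n + 1) s) =
            X * (X ^ n * (boundaryExtension d (n + 1) (fun s => g (n + 1) s - g' (n + 1) s) s +
              boundaryExtension d (n + 1) (fun s => g (n + 1) s - g' (n + 1) s) (s + 2))) := by
          simp only [boundaryExtension_sub]
          linear_combination h1 - h2 + ih s hs
        rw [heq, pow_succ']
        exact mul_dvd_mul_left _ (((hext s).add (hext (s + 2))).mul_left _)
    intro s hs
    exact sub_eq_zero.1 (eq_zero_of_forall_X_pow_dvd fun m => key m s hs)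

/-! ### Raising the level by two -/

theorem constantCoeff_pochhammerQ {f : ℕ} (hf : f ≠ 0) (n : ℕ) :
    constantCoeff (pochhammerQ (X ^ f) (X ^ f) n) = 1 := by
  simp [pochhammerQ, map_prod, hf]

theorem pochhammerQ_mul_inv {f : ℕ} (hf : f ≠ 0) (n : ℕ) :
    pochhammerQ (X ^ f) (X ^ f) n * (pochhammerQ (X ^ f) (X ^ f) n)⁻¹ = 1 :=
  PowerSeries.mul_inv_cancel _ (by simp [constantCoeff_pochhammerQ hf])

theorem pochhammerQ_inv_succ {f : ℕ} (hf : f ≠ 0) (n : ℕ) :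
    (1 - X ^ (f * (n + 1))) * (pochhammerQ (X ^ f) (X ^ f) (n + 1))⁻¹ =
      (pochhammerQ (X ^ f) (X ^ f) n)⁻¹ := by
  have h : pochhammerQ (X ^ f) (X ^ f) (n + 1) =
      pochhammerQ (X ^ f) (X ^ f) n * (1 - X ^ (f * (n + 1))) := by
    rw [pochhammerQ, Finset.prod_range_succ, ← pochhammerQ]
    ring
  have h1 := pochhammerQ_mul_inv hf n
  have h2 := pochhammerQ_mul_inv hf (n + 1)
  rw [h] at h2 ⊢
  linear_combination
    (-(1 - X ^ (f * (n + 1))) * (pochhammerQ (X ^ f) (X ^ f) n * (1 - X ^ (f * (n + 1))))⁻¹) * h1 +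
    (pochhammerQ (X ^ f) (X ^ f) n)⁻¹ * h2

theorem pochhammerQ_X_inv_succ (n : ℕ) :
    (1 - X ^ (n + 1)) * (pochhammerQ X X (n + 1))⁻¹ = (pochhammerQ X X n)⁻¹ := by
  simpa using pochhammerQ_inv_succ one_ne_zero n

/-- The transform `∑_{n ≤ a} q ^ n² / (q; q)_{a - n} * u n` of a sequence `u`, which is the
step `β ↦ β'` of Bailey's lemma relative to `1`. -/
noncomputable def baileyTransform (u : ℕ → ℚ⟦X⟧) (a : ℕ) : ℚ⟦X⟧ :=
  ∑ n ∈ Finset.range (a + 1), X ^ n ^ 2 * (pochhammerQ X X (a - n))⁻¹ * u n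

/-- The transform turns the three-term relation of a triple of sequences into itself. This rests
on the factorisation `1 + q^{2a} - q^{a-n} - q^{a+n} = (1 - q^{a-n}) (1 - q^{a+n})`. -/
theorem baileyTransform_three_term {u v w : ℕ → ℚ⟦X⟧} (h0 : v 0 + w 0 = 2 * u 0)
    (h : ∀ n, (1 + X ^ (2 * (n + 1))) * u (n + 1) - X ^ (n + 1) * (v (n + 1) + w (n + 1)) = u n)
    (a : ℕ) :
    (1 + X ^ (2 * (a + 1))) * baileyTransform u (a + 1) -
      X ^ (a + 1) * (baileyTransform v (a + 1) + baileyTransform w (a + 1)) =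
        baileyTransform u a := by
  -- `t n` stands for `u (n - 1)`, with `u (-1) = 0`
  let t : ℕ → ℚ⟦X⟧ := fun n => (1 + X ^ (2 * n)) * u n - X ^ n * (v n + w n)
  have ht0 : t 0 = 0 := by simp only [t, h0]; ring
  have hsplit : (1 + X ^ (2 * (a + 1))) * baileyTransform u (a + 1) -
      X ^ (a + 1) * (baileyTransform v (a + 1) + baileyTransform w (a + 1)) =
      ∑ n ∈ Finset.range (a + 2), X ^ n ^ 2 * (pochhammerQ X X (a + 1 - n))⁻¹ *
        ((1 - X ^ (a + 1 - n)) * (1 - X ^ (a + 1 + n)) * u n) +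
      ∑ n ∈ Finset.range (a + 2), X ^ n ^ 2 * (pochhammerQ X X (a + 1 - n))⁻¹ *
        (X ^ (a + 1 - n) * t n) := by
    simp only [baileyTransform, Finset.mul_sum, ← Finset.sum_add_distrib, ← Finset.sum_sub_distrib]
    refine Finset.sum_congr rfl fun n hn => ?_
    obtain ⟨m, hm⟩ := Nat.exists_eq_add_of_le (Nat.le_of_lt_succ (Finset.mem_range.1 hn))
    rw [hm, Nat.add_sub_cancel_left]
    simp only [t]
    ring
  rw [hsplit, Finset.sum_range_succ _ (a + 1), Finset.sum_range_succ' _ (a + 1), ht0,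
    baileyTransform]
  simp only [Nat.sub_self, pow_zero, sub_self, zero_mul, mul_zero, add_zero,
    ← Finset.sum_add_distrib]
  refine Finset.sum_congr rfl fun n hn => ?_
  obtain ⟨m, rfl⟩ := Nat.exists_eq_add_of_le (Nat.le_of_lt_succ (Finset.mem_range.1 hn))
  have ht : t (n + 1) = u n := h n
  rw [ht, show n + m + 1 - n = m + 1 by omega, show n + m + 1 - (n + 1) = m by omega,
    Nat.add_sub_cancel_left]
  linear_combination (X ^ n ^ 2 * (1 - X ^ (n + m + 1 + n)) * u n) * pochhammerQ_X_inv_succ m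

/-- The relation at the boundary: if `v n = q ^ n * u n`, then the transforms of `v` and `u` are
the first two values of a row that satisfies the recurrence with its boundary condition. -/
theorem baileyTransform_two_term {u v : ℕ → ℚ⟦X⟧} (h : ∀ n, v n = X ^ n * u n) (a : ℕ) :
    baileyTransform v (a + 1) - X ^ (a + 1) * baileyTransform u (a + 1) = baileyTransform v a := by
  simp only [baileyTransform, Finset.mul_sum, ← Finset.sum_sub_distrib, h]
  rw [Finset.sum_range_succ _ (a + 1)]
  simp only [Nat.sub_self]
  have hlast : X ^ (a + 1) ^ 2 * (pochhammerQ X X 0)⁻¹ * (X ^ (a + 1) * u (a + 1)) -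
      X ^ (a + 1) * (X ^ (a + 1) ^ 2 * (pochhammerQ X X 0)⁻¹ * u (a + 1)) = 0 := by ring
  rw [hlast, add_zero]
  refine Finset.sum_congr rfl fun n hn => ?_
  obtain ⟨m, rfl⟩ := Nat.exists_eq_add_of_le (Nat.le_of_lt_succ (Finset.mem_range.1 hn))
  rw [show n + m + 1 - n = m + 1 by omega, Nat.add_sub_cancel_left]
  linear_combination (X ^ n ^ 2 * X ^ n * u n) * pochhammerQ_X_inv_succ m

/-- The transform of a solution at level `d`, continued by its boundary values, is a solution at
level `d + 2`. -/
theorem CylindricRecurrence.baileyTransform {d : ℕ} {g : ℕ → ℕ → ℚ⟦X⟧}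
    (hg : CylindricRecurrence d g) :
    CylindricRecurrence (d + 2) fun a s =>
      baileyTransform (fun n => boundaryExtension d n (g n) s) a := by
  have hone : ∀ s, boundaryExtension d 0 (g 0) s = 1 := by
    intro s
    cases s with
    | zero => simp [boundaryExtension, hg.zero 0 (Nat.zero_le d)]
    | succ s =>
      simp only [boundaryExtension]
      split_ifs with hs
      · exact hg.zero s hs
      · simp [hg.zero d le_rfl]
  refine ⟨fun s _ => ?_, fun a s hs => ?_⟩
  · have h0 : pochhammerQ X X 0 = 1 := by simp [pochhammerQ]
    simp [_root_.baileyTransform, hone, h0]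
  · rcases Nat.eq_zero_or_pos s with rfl | hs0
    · rw [boundaryExtension_succ (show 1 ≤ d + 2 by omega)]
      simp only [boundaryExtension]
      have := baileyTransform_two_term (u := fun n => boundaryExtension d n (g n) 1)
        (v := fun n => boundaryExtension d n (g n) 0)
        (fun n => by simp [boundaryExtension]) a
      simp only [boundaryExtension] at this
      linear_combination this
    obtain ⟨s, rfl⟩ := Nat.exists_eq_succ_of_ne_zero hs0.ne'
    rcases hs.eq_or_lt with hlast | hlt
    · obtain rfl : s = d + 1 := by omega
      rw [boundaryExtension_succ (show d + 1 ≤ d + 2 by omega),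
        show d + 1 + 1 + 2 = (d + 2) + 2 by rfl, boundaryExtension_last]
      have := baileyTransform_two_term (u := fun n => boundaryExtension d n (g n) (d + 1))
        (v := fun n => boundaryExtension d n (g n) (d + 2))
        (fun n => by rw [boundaryExtension_last, boundaryExtension_succ le_rfl]) a
      linear_combination this
    · rw [boundaryExtension_succ (show s ≤ d + 2 by omega),
        boundaryExtension_succ (show s + 2 ≤ d + 2 by omega)]
      refine baileyTransform_three_term ?_ (fun n => ?_) a
      · rw [hone, hone, hone]; norm_num
      · have hsd : s ≤ d := by omega
        have := hg.succ n s hsd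
        rwa [boundaryExtension_succ hsd, boundaryExtension_succ hsd]

/-! ### Two-rowed cylindric partitions -/

/-- The conditions on a two-rowed cylindric partition of profile `[d - s, s]` written out. -/
theorem isCylindricPartition_two_iff {d s : ℕ} (hs : s ≤ d) {π : Fin 2 × ℕ →₀ ℕ} :
    IsCylindricPartition (∑ l, (![d - s, s] : Fin 2 → ℕ) l) (weightShift ![d - s, s]) π ↔
      (∀ j ≤ s, π (0, j) = 0) ∧ π (1, 0) = 0 ∧
      (∀ j, s < j → π (0, j + 1) ≤ π (0, j)) ∧ (∀ j, 0 < j → π (1, j + 1) ≤ π (1, j)) ∧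
      (∀ j, s < j → π (1, j) ≤ π (0, j)) ∧ (∀ j, 0 < j → π (0, j + d) ≤ π (1, j)) := by
  have h0 : weightShift ![d - s, s] 0 = s := by
    have : Finset.univ.filter (fun l : Fin 2 => 0 < l) = {1} := by decide
    rw [weightShift, this]
    simp
  have h1 : weightShift ![d - s, s] 1 = 0 := by
    have : Finset.univ.filter (fun l : Fin 2 => 1 < l) = ∅ := by decide
    rw [weightShift, this]
    simp
  have hd : ∑ l, (![d - s, s] : Fin 2 → ℕ) l = d := by
    simp [Fin.sum_univ_two]
    omega
  rw [hd]
  constructor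
  · intro h
    refine ⟨fun j hj => h.outside 0 j (by rwa [h0]), h.outside 1 0 (by rw [h1]),
      fun j hj => h.row 0 j (by rwa [h0]), fun j hj => h.row 1 j (by rwa [h1]),
      fun j hj => h.column 0 1 rfl j (by rwa [h0]) (by rw [h1]; omega),
      fun j hj => h.cylindric 0 1 rfl rfl j (by rwa [h1]) (by rw [h0]; omega)⟩
  · rintro ⟨ho0, ho1, hr0, hr1, hc, hcyl⟩
    refine ⟨fun i j hj => ?_, fun i j hj => ?_, fun i i' hi j hj hj' => ?_,
      fun i i' hi hi' j hj hj' => ?_⟩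
    · fin_cases i
      · exact ho0 j (by simpa [h0] using hj)
      · obtain rfl : j = 0 := by simpa [h1] using hj
        exact ho1
    · fin_cases i
      · exact hr0 j (by simpa [h0] using hj)
      · exact hr1 j (by simpa [h1] using hj)
    · obtain rfl : i = 0 := Fin.ext (by simp only [Fin.val_zero]; omega)
      obtain rfl : i' = 1 := Fin.ext hi
      exact hc j (by rwa [h0] at hj)
    · obtain rfl : i = 0 := Fin.ext hi
      obtain rfl : i' = 1 := Fin.ext (Nat.succ_injective hi')
      exact hcyl j (by rwa [h1] at hj)

theorem mem_cylindricPartitions_two_iff {d s : ℕ} (hs : s ≤ d) {a : ℕ} {π : Fin 2 × ℕ →₀ ℕ} :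
    π ∈ cylindricPartitions ![d - s, s] a ↔
      ((∀ j ≤ s, π (0, j) = 0) ∧ π (1, 0) = 0 ∧
      (∀ j, s < j → π (0, j + 1) ≤ π (0, j)) ∧ (∀ j, 0 < j → π (1, j + 1) ≤ π (1, j)) ∧
      (∀ j, s < j → π (1, j) ≤ π (0, j)) ∧ (∀ j, 0 < j → π (0, j + d) ≤ π (1, j))) ∧
      (∀ j, π (0, j) ≤ a) ∧ (∀ j, π (1, j) ≤ a) := by
  rw [cylindricPartitions, Set.mem_ofPred_eq, isCylindricPartition_two_iff hs]
  refine and_congr_right fun _ => ⟨fun h => ⟨fun j => h _, fun j => h _⟩, ?_⟩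
  rintro ⟨h0, h1⟩ ⟨i, j⟩
  fin_cases i
  exacts [h0 j, h1 j]

/-- Two-rowed cylindric partitions of profile `[d - s, s]` and entries at most `a` whose first row
starts with `a`. -/
def firstRowMax (d s a : ℕ) : Set (Fin 2 × ℕ →₀ ℕ) :=
  {π ∈ cylindricPartitions ![d - s, s] a | π (0, s + 1) = a}

/-- Two-rowed cylindric partitions of profile `[d - s, s]` and entries at most `a` whose second
row starts with `a`. -/
def secondRowMax (d s a : ℕ) : Set (Fin 2 × ℕ →₀ ℕ) :=
  {π ∈ cylindricPartitions ![d - s, s] a | π (1, 1) = a}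

/-- Shifting both rows one step to the right. -/
def shiftRight : Fin 2 × ℕ ↪ Fin 2 × ℕ :=
  ⟨fun p => (p.1, p.2 + 1), fun p p' h => by
    simp only [Prod.mk.injEq, add_left_inj] at h
    exact Prod.ext h.1 h.2⟩

theorem shiftRight_apply (i : Fin 2) (j : ℕ) : shiftRight (i, j) = (i, j + 1) := rfl

/-- Prepending an entry `a` to the first row of an array whose first row starts in column
`s + 2`. -/
noncomputable def prependFirst (s a : ℕ) (π : Fin 2 × ℕ →₀ ℕ) : Fin 2 × ℕ →₀ ℕ :=
  Finsupp.single (0, s + 1) a + π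

/-- Prepending an entry `a` to the second row, after both rows have moved one step to the right
to make room for it. -/
noncomputable def prependSecond (a : ℕ) (π : Fin 2 × ℕ →₀ ℕ) : Fin 2 × ℕ →₀ ℕ :=
  Finsupp.single (1, 1) a + π.embDomain shiftRight

theorem prependFirst_zero_self (s a : ℕ) (π : Fin 2 × ℕ →₀ ℕ) :
    prependFirst s a π (0, s + 1) = a + π (0, s + 1) := by
  simp [prependFirst]

theorem prependFirst_zero_of_ne {s j : ℕ} (hj : j ≠ s + 1) (a : ℕ) (π : Fin 2 × ℕ →₀ ℕ) :
    prependFirst s a π (0, j) = π (0, j) := by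
  simp [prependFirst, Ne.symm hj]

theorem prependFirst_one (s a j : ℕ) (π : Fin 2 × ℕ →₀ ℕ) :
    prependFirst s a π (1, j) = π (1, j) := by
  simp [prependFirst]

theorem embDomain_shiftRight_zero (π : Fin 2 × ℕ →₀ ℕ) (i : Fin 2) :
    π.embDomain shiftRight (i, 0) = 0 :=
  Finsupp.embDomain_of_notMem_range _ _ _ (by rintro ⟨⟨i', j⟩, hp⟩; simp [shiftRight_apply] at hp)

theorem embDomain_shiftRight_succ (π : Fin 2 × ℕ →₀ ℕ) (i : Fin 2) (j : ℕ) :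
    π.embDomain shiftRight (i, j + 1) = π (i, j) :=
  Finsupp.embDomain_apply_self shiftRight π (i, j)

theorem prependSecond_column_zero (a : ℕ) (π : Fin 2 × ℕ →₀ ℕ) (i : Fin 2) :
    prependSecond a π (i, 0) = 0 := by
  simp [prependSecond, embDomain_shiftRight_zero]

theorem prependSecond_zero_succ (a j : ℕ) (π : Fin 2 × ℕ →₀ ℕ) :
    prependSecond a π (0, j + 1) = π (0, j) := by
  simp [prependSecond, embDomain_shiftRight_succ]

theorem prependSecond_one_one (a : ℕ) (π : Fin 2 × ℕ →₀ ℕ) :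
    prependSecond a π (1, 1) = a + π (1, 0) := by
  simp [prependSecond, embDomain_shiftRight_succ π 1 0]

theorem prependSecond_one_succ {j : ℕ} (hj : 0 < j) (a : ℕ) (π : Fin 2 × ℕ →₀ ℕ) :
    prependSecond a π (1, j + 1) = π (1, j) := by
  simp [prependSecond, embDomain_shiftRight_succ, hj.ne']

theorem prependFirst_injective (s a : ℕ) : Function.Injective (prependFirst s a) :=
  fun _ _ h => add_left_cancel h

theorem prependSecond_injective (a : ℕ) : Function.Injective (prependSecond a) :=
  fun _ _ h => Finsupp.embDomain_injective shiftRight (add_left_cancel h)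

theorem arrayNorm_single_add (p : Fin 2 × ℕ) (a : ℕ) (π : Fin 2 × ℕ →₀ ℕ) :
    arrayNorm (Finsupp.single p a + π) = a + arrayNorm π := by
  rw [arrayNorm, Finsupp.sum_add_index' (fun _ => rfl) (fun _ _ _ => rfl),
    Finsupp.sum_single_index rfl, arrayNorm]

theorem arrayNorm_prependFirst (s a : ℕ) (π : Fin 2 × ℕ →₀ ℕ) :
    arrayNorm (prependFirst s a π) = a + arrayNorm π :=
  arrayNorm_single_add _ _ _

theorem arrayNorm_prependSecond (a : ℕ) (π : Fin 2 × ℕ →₀ ℕ) :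
    arrayNorm (prependSecond a π) = a + arrayNorm π := by
  rw [prependSecond, arrayNorm_single_add, arrayNorm, Finsupp.sum_embDomain, arrayNorm]

/-- For `s < d` the column of the prepended entry lies to the left of the displaced second row, so
that the cylindric condition does not bound this entry. -/
theorem prependFirst_mem {d s a : ℕ} (hs : s < d) {π : Fin 2 × ℕ →₀ ℕ}
    (h : π ∈ cylindricPartitions ![d - (s + 1), s + 1] a) :
    prependFirst s a π ∈ firstRowMax d s a := by
  rw [mem_cylindricPartitions_two_iff hs] at h
  obtain ⟨⟨ho0, ho1, hr0, hr1, hc, hcyl⟩, hb0, hb1⟩ := h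
  have hself : prependFirst s a π (0, s + 1) = a := by
    rw [prependFirst_zero_self, ho0 _ le_rfl, add_zero]
  refine ⟨(mem_cylindricPartitions_two_iff hs.le).2 ⟨⟨fun j hj => ?_, ?_, fun j hj => ?_,
    fun j hj => ?_, fun j hj => ?_, fun j hj => ?_⟩, fun j => ?_, fun j => ?_⟩, hself⟩
  · rw [prependFirst_zero_of_ne (by omega)]
    exact ho0 j (by omega)
  · rwa [prependFirst_one]
  · rw [prependFirst_zero_of_ne (show j + 1 ≠ s + 1 by omega)]
    by_cases hj1 : j = s + 1
    · rw [hj1, hself]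
      exact hb0 _
    · rw [prependFirst_zero_of_ne hj1]
      exact hr0 j (by omega)
  · simpa only [prependFirst_one] using hr1 j hj
  · rw [prependFirst_one]
    by_cases hj1 : j = s + 1
    · rw [hj1, hself]
      exact hb1 _
    · rw [prependFirst_zero_of_ne hj1]
      exact hc j (by omega)
  · rw [prependFirst_one, prependFirst_zero_of_ne (by omega)]
    exact hcyl j hj
  · by_cases hj1 : j = s + 1
    · rw [hj1, hself]
    · rw [prependFirst_zero_of_ne hj1]
      exact hb0 j
  · rw [prependFirst_one]
    exact hb1 j

theorem image_prependFirst {d s a : ℕ} (hs : s < d) :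
    prependFirst s a '' cylindricPartitions ![d - (s + 1), s + 1] a = firstRowMax d s a := by
  refine Set.Subset.antisymm (Set.image_subset_iff.2 fun π h => prependFirst_mem hs h) ?_
  rintro π ⟨h, ha⟩
  have heq : prependFirst s a (π.erase (0, s + 1)) = π := by
    rw [prependFirst, ← ha, Finsupp.single_add_erase]
  refine ⟨π.erase (0, s + 1), ?_, heq⟩
  have h0 : ∀ j, j ≠ s + 1 → π.erase (0, s + 1) (0, j) = π (0, j) := fun j hj =>
    Finsupp.erase_ne (by simpa using hj)
  have h1 : ∀ j, π.erase (0, s + 1) (1, j) = π (1, j) := fun j => Finsupp.erase_ne (by simp)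
  have hle : ∀ p, π.erase (0, s + 1) p ≤ π p := fun p => by
    rw [Finsupp.erase_apply]
    split_ifs
    exacts [Nat.zero_le _, le_rfl]
  rw [mem_cylindricPartitions_two_iff hs.le] at h
  obtain ⟨⟨ho0, ho1, hr0, hr1, hc, hcyl⟩, hb0, hb1⟩ := h
  refine (mem_cylindricPartitions_two_iff hs).2 ⟨⟨fun j hj => ?_, ?_, fun j hj => ?_,
    fun j hj => ?_, fun j hj => ?_, fun j hj => ?_⟩, fun j => ?_, fun j => ?_⟩
  · by_cases hj1 : j = s + 1
    · rw [hj1, Finsupp.erase_same]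
    · rw [h0 j hj1]
      exact ho0 j (by omega)
  · rwa [h1]
  · rw [h0 j (by omega), h0 (j + 1) (by omega)]
    exact hr0 j (by omega)
  · simpa only [h1] using hr1 j hj
  · rw [h1, h0 j (by omega)]
    exact hc j (by omega)
  · rw [h1]
    exact (hle _).trans (hcyl j hj)
  · exact (hle _).trans (hb0 j)
  · exact (hle _).trans (hb1 j)

theorem prependSecond_mem {d s a : ℕ} (hs : s < d) {π : Fin 2 × ℕ →₀ ℕ}
    (h : π ∈ cylindricPartitions ![d - s, s] a) :
    prependSecond a π ∈ secondRowMax d (s + 1) a := by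
  rw [mem_cylindricPartitions_two_iff hs.le] at h
  obtain ⟨⟨ho0, ho1, hr0, hr1, hc, hcyl⟩, hb0, hb1⟩ := h
  have hself : prependSecond a π (1, 1) = a := by
    rw [prependSecond_one_one, ho1, add_zero]
  refine ⟨(mem_cylindricPartitions_two_iff hs).2 ⟨⟨fun j hj => ?_, ?_, fun j hj => ?_,
    fun j hj => ?_, fun j hj => ?_, fun j hj => ?_⟩, fun j => ?_, fun j => ?_⟩, hself⟩
  · cases j with
    | zero => exact prependSecond_column_zero _ _ _
    | succ j =>
      rw [prependSecond_zero_succ]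
      exact ho0 j (by omega)
  · exact prependSecond_column_zero _ _ _
  · obtain ⟨j, rfl⟩ := Nat.exists_eq_succ_of_ne_zero (show j ≠ 0 by omega)
    simp only [Nat.succ_eq_add_one, prependSecond_zero_succ]
    exact hr0 j (by omega)
  · rw [prependSecond_one_succ hj]
    obtain ⟨j, rfl⟩ := Nat.exists_eq_succ_of_ne_zero hj.ne'
    rcases Nat.eq_zero_or_pos j with rfl | hj0
    · rw [Nat.succ_eq_add_one, zero_add, hself]
      exact hb1 _
    · rw [Nat.succ_eq_add_one, prependSecond_one_succ hj0]
      exact hr1 j hj0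
  · obtain ⟨j, rfl⟩ := Nat.exists_eq_succ_of_ne_zero (show j ≠ 0 by omega)
    rw [Nat.succ_eq_add_one, prependSecond_zero_succ, prependSecond_one_succ (by omega)]
    exact hc j (by omega)
  · obtain ⟨j, rfl⟩ := Nat.exists_eq_succ_of_ne_zero hj.ne'
    rw [Nat.succ_eq_add_one, Nat.add_right_comm, prependSecond_zero_succ]
    rcases Nat.eq_zero_or_pos j with rfl | hj0
    · rw [zero_add, zero_add, hself]
      exact hb0 _
    · rw [prependSecond_one_succ hj0]
      exact hcyl j hj0
  · cases j with
    | zero => rw [prependSecond_column_zero]; exact Nat.zero_le a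
    | succ j => rw [prependSecond_zero_succ]; exact hb0 j
  · cases j with
    | zero => rw [prependSecond_column_zero]; exact Nat.zero_le a
    | succ j =>
      rcases Nat.eq_zero_or_pos j with rfl | hj0
      · rw [zero_add, hself]
      · rw [prependSecond_one_succ hj0]; exact hb1 j

theorem image_prependSecond {d s a : ℕ} (hs : s < d) :
    prependSecond a '' cylindricPartitions ![d - s, s] a = secondRowMax d (s + 1) a := by
  refine Set.Subset.antisymm (Set.image_subset_iff.2 fun π h => prependSecond_mem hs h) ?_
  rintro π ⟨h, ha⟩
  rw [mem_cylindricPartitions_two_iff hs] at h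
  obtain ⟨⟨ho0, ho1, hr0, hr1, hc, hcyl⟩, hb0, hb1⟩ := h
  let ρ := (π.erase (1, 1)).comapDomain shiftRight shiftRight.injective.injOn
  have h0 : ∀ j, ρ (0, j) = π (0, j + 1) := fun j => by
    simp [ρ, shiftRight_apply, Finsupp.comapDomain_apply]
  have h10 : ρ (1, 0) = 0 := by
    simp [ρ, shiftRight_apply, Finsupp.comapDomain_apply]
  have h1 : ∀ j, 0 < j → ρ (1, j) = π (1, j + 1) := fun j hj => by
    simp [ρ, shiftRight_apply, Finsupp.comapDomain_apply, hj.ne']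
  refine ⟨ρ, (mem_cylindricPartitions_two_iff hs.le).2 ⟨⟨fun j hj => ?_, h10, fun j hj => ?_,
    fun j hj => ?_, fun j hj => ?_, fun j hj => ?_⟩, fun j => ?_, fun j => ?_⟩, ?_⟩
  · rw [h0]
    exact ho0 _ (by omega)
  · rw [h0, h0]
    exact hr0 _ (by omega)
  · rw [h1 j hj, h1 _ j.succ_pos]
    exact hr1 _ (by omega)
  · rw [h0, h1 j (by omega)]
    exact hc _ (by omega)
  · rw [h0, h1 j hj, Nat.add_right_comm]
    exact hcyl _ (by omega)
  · rw [h0]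
    exact hb0 _
  · rcases Nat.eq_zero_or_pos j with rfl | hj
    · rw [h10]
      exact Nat.zero_le a
    · rw [h1 j hj]
      exact hb1 _
  · ext ⟨i, j⟩
    fin_cases i
    · cases j with
      | zero => exact (prependSecond_column_zero _ _ _).trans (ho0 0 (Nat.zero_le _)).symm
      | succ j => exact (prependSecond_zero_succ _ _ _).trans (h0 j)
    · rcases j with _ | _ | j
      · exact (prependSecond_column_zero _ _ _).trans ho1.symm
      · exact (prependSecond_one_one _ _).trans (by rw [h10, add_zero, ← ha]; rfl)
      · exact (prependSecond_one_succ j.succ_pos _ _).trans (h1 _ j.succ_pos)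

/-- Removing the maximal entry of the second row does not affect whether the first row starts
with the maximal entry. -/
theorem image_prependSecond_firstRowMax {d s a : ℕ} (hs : s < d) :
    prependSecond a '' firstRowMax d s a = firstRowMax d (s + 1) a ∩ secondRowMax d (s + 1) a := by
  ext π
  constructor
  · rintro ⟨ρ, ⟨hρ, hmax⟩, rfl⟩
    have h := prependSecond_mem hs hρ
    exact ⟨⟨h.1, by rw [prependSecond_zero_succ, hmax]⟩, h⟩
  · rintro ⟨⟨_, hmax⟩, h⟩
    obtain ⟨ρ, hρ, rfl⟩ := (image_prependSecond hs).symm.subset h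
    exact ⟨ρ, ⟨hρ, by rwa [prependSecond_zero_succ] at hmax⟩, rfl⟩

theorem cylindricPartitions_succ {d s : ℕ} (hs : s ≤ d) (a : ℕ) :
    cylindricPartitions ![d - s, s] (a + 1) = cylindricPartitions ![d - s, s] a ∪
      (firstRowMax d s (a + 1) ∪ secondRowMax d s (a + 1)) := by
  ext π
  constructor
  · intro h
    by_cases h0 : π (0, s + 1) = a + 1
    · exact Or.inr (Or.inl ⟨h, h0⟩)
    by_cases h1 : π (1, 1) = a + 1
    · exact Or.inr (Or.inr ⟨h, h1⟩)
    obtain ⟨hπ, hb0, hb1⟩ := (mem_cylindricPartitions_two_iff hs).1 h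
    refine Or.inl ((mem_cylindricPartitions_two_iff hs).2 ⟨hπ, fun j => ?_, fun j => ?_⟩)
    · rcases Nat.lt_or_ge s j with hj | hj
      · induction j, hj using Nat.le_induction with
        | base => exact Nat.le_of_lt_succ ((hb0 (s + 1)).lt_of_ne h0)
        | succ j hj ih => exact (hπ.2.2.1 j hj).trans ih
      · rw [hπ.1 j hj]
        exact Nat.zero_le a
    · rcases Nat.lt_or_ge 0 j with hj | hj
      · induction j, hj using Nat.le_induction with
        | base => exact Nat.le_of_lt_succ ((hb1 1).lt_of_ne h1)
        | succ j hj ih => exact (hπ.2.2.2.1 j hj).trans ih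
      · rw [Nat.le_zero.1 hj, hπ.2.1]
        exact Nat.zero_le a
  · rintro (h | h | h)
    · exact ⟨h.1, fun p => (h.2 p).trans a.le_succ⟩
    · exact h.1
    · exact h.1

theorem disjoint_cylindricPartitions_max (d s a : ℕ) :
    Disjoint (cylindricPartitions ![d - s, s] a)
      (firstRowMax d s (a + 1) ∪ secondRowMax d s (a + 1)) := by
  rw [Set.disjoint_left]
  rintro π h (⟨_, hmax⟩ | ⟨_, hmax⟩)
  · have := h.2 (0, s + 1)
    omega
  · have := h.2 (1, 1)
    omega

theorem secondRowMax_subset (d a : ℕ) : secondRowMax d 0 a ⊆ firstRowMax d 0 a := by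
  rintro π ⟨h, hmax⟩
  obtain ⟨hπ, hb0, _⟩ := (mem_cylindricPartitions_two_iff (Nat.zero_le d)).1 h
  exact ⟨h, (hb0 1).antisymm (hmax.symm.le.trans (hπ.2.2.2.2.1 1 one_pos))⟩

theorem firstRowMax_subset (d a : ℕ) : firstRowMax d d a ⊆ secondRowMax d d a := by
  rintro π ⟨h, hmax⟩
  obtain ⟨hπ, _, hb1⟩ := (mem_cylindricPartitions_two_iff le_rfl).1 h
  refine ⟨h, (hb1 1).antisymm (hmax.symm.le.trans ?_)⟩
  rw [add_comm]
  exact hπ.2.2.2.2.2 1 one_pos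

/-! ### The recurrence for the generating functions -/

/-- The generating function `∑ q ^ |π|` over a set of two-rowed arrays. It counts a norm as `0`
when infinitely many members of the set have that norm. -/
noncomputable def normGenFun (S : Set (Fin 2 × ℕ →₀ ℕ)) : ℚ⟦X⟧ :=
  PowerSeries.mk fun n => (({π ∈ S | arrayNorm π = n}.ncard : ℕ) : ℚ)

theorem normGenFun_image {φ : (Fin 2 × ℕ →₀ ℕ) → Fin 2 × ℕ →₀ ℕ} {a : ℕ}
    (hφ : Function.Injective φ) (hnorm : ∀ π, arrayNorm (φ π) = a + arrayNorm π)
    (S : Set (Fin 2 × ℕ →₀ ℕ)) : normGenFun (φ '' S) = X ^ a * normGenFun S := by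
  ext n
  rw [coeff_X_pow_mul', normGenFun, normGenFun, coeff_mk]
  split_ifs with h
  · rw [coeff_mk]
    have hset : {π ∈ φ '' S | arrayNorm π = n} = φ '' {π ∈ S | arrayNorm π = n - a} := by
      ext π
      constructor
      · rintro ⟨⟨ρ, hρ, rfl⟩, hn⟩
        exact ⟨ρ, ⟨hρ, by rw [hnorm] at hn; omega⟩, rfl⟩
      · rintro ⟨ρ, ⟨hρ, hn⟩, rfl⟩
        exact ⟨⟨ρ, hρ, rfl⟩, by rw [hnorm]; omega⟩
    rw [hset, Set.ncard_image_of_injective _ hφ]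
  · have : {π ∈ φ '' S | arrayNorm π = n} = ∅ := by
      rw [Set.eq_empty_iff_forall_notMem]
      rintro _ ⟨⟨ρ, _, rfl⟩, hn⟩
      rw [hnorm] at hn
      omega
    rw [this, Set.ncard_empty, Nat.cast_zero]

theorem normGenFun_union_add_inter {m : Fin 2 → ℕ} {a : ℕ} {S T : Set (Fin 2 × ℕ →₀ ℕ)}
    (hS : S ⊆ cylindricPartitions m a) (hT : T ⊆ cylindricPartitions m a) :
    normGenFun (S ∪ T) + normGenFun (S ∩ T) = normGenFun S + normGenFun T := by
  ext n
  simp only [normGenFun, map_add, coeff_mk]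
  have hfin := cylindricPartitions_norm_finite m a n
  have h := Set.ncard_union_add_ncard_inter {π ∈ S | arrayNorm π = n} {π ∈ T | arrayNorm π = n}
    (hfin.subset fun π h => ⟨hS h.1, h.2⟩) (hfin.subset fun π h => ⟨hT h.1, h.2⟩)
  have hu : {π ∈ S | arrayNorm π = n} ∪ {π ∈ T | arrayNorm π = n} =
      {π ∈ S ∪ T | arrayNorm π = n} := by
    ext π
    exact or_and_right.symm
  have hi : {π ∈ S | arrayNorm π = n} ∩ {π ∈ T | arrayNorm π = n} =
      {π ∈ S ∩ T | arrayNorm π = n} := by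
    ext π
    exact and_and_right.symm
  rw [hu, hi] at h
  exact_mod_cast h

theorem cylindricGenFun_succ {d s : ℕ} (hs : s ≤ d) (a : ℕ) :
    cylindricGenFun ![d - s, s] (a + 1) = cylindricGenFun ![d - s, s] a +
      normGenFun (firstRowMax d s (a + 1) ∪ secondRowMax d s (a + 1)) := by
  have h := normGenFun_union_add_inter (m := ![d - s, s]) (a := a + 1)
    (S := cylindricPartitions ![d - s, s] a)
    (T := firstRowMax d s (a + 1) ∪ secondRowMax d s (a + 1))
    (by rw [cylindricPartitions_succ hs]; exact Set.subset_union_left)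
    (by rw [cylindricPartitions_succ hs]; exact Set.subset_union_right)
  have hempty : normGenFun ∅ = 0 := by
    ext n
    simp [normGenFun]
  rwa [(disjoint_cylindricPartitions_max d s a).inter_eq, hempty, add_zero,
    ← cylindricPartitions_succ hs] at h

theorem normGenFun_firstRowMax {d s : ℕ} (hs : s < d) (a : ℕ) :
    normGenFun (firstRowMax d s a) = X ^ a * cylindricGenFun ![d - (s + 1), s + 1] a := by
  rw [← image_prependFirst hs,
    normGenFun_image (prependFirst_injective s a) (arrayNorm_prependFirst s a)]
  rfl

theorem normGenFun_secondRowMax {d s : ℕ} (hs : s < d) (a : ℕ) :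
    normGenFun (secondRowMax d (s + 1) a) = X ^ a * cylindricGenFun ![d - s, s] a := by
  rw [← image_prependSecond hs,
    normGenFun_image (prependSecond_injective a) (arrayNorm_prependSecond a)]
  rfl

theorem cylindricGenFun_zero (m : Fin 2 → ℕ) : cylindricGenFun m 0 = 1 := by
  have hset : cylindricPartitions m 0 = {0} := by
    ext π
    constructor
    · rintro ⟨_, h⟩
      exact Finsupp.ext fun p => Nat.le_zero.1 (h p)
    · rintro rfl
      exact ⟨⟨fun _ _ _ => rfl, fun _ _ _ => le_rfl, fun _ _ _ _ _ _ => le_rfl,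
        fun _ _ _ _ _ _ _ => le_rfl⟩, fun _ => le_rfl⟩
  ext n
  rw [cylindricGenFun, coeff_mk, hset, coeff_one]
  split_ifs with hn
  · have : {π ∈ ({0} : Set (Fin 2 × ℕ →₀ ℕ)) | arrayNorm π = n} = {0} := by
      ext π
      simp only [Set.mem_ofPred_eq, Set.mem_singleton_iff, and_iff_left_iff_imp]
      rintro rfl
      rw [hn]
      rfl
    rw [this, Set.ncard_singleton, Nat.cast_one]
  · have : {π ∈ ({0} : Set (Fin 2 × ℕ →₀ ℕ)) | arrayNorm π = n} = ∅ := by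
      rw [Set.eq_empty_iff_forall_notMem]
      rintro π ⟨rfl, h⟩
      exact hn h.symm
    rw [this, Set.ncard_empty, Nat.cast_zero]

/-- Inclusion–exclusion over the rows that start with the largest admissible entry. In the
boundary cases `s = 0` and `s = d` one of the two conditions implies the other. -/
theorem cylindricRecurrence_cylindricGenFun {d : ℕ} (hd : 0 < d) :
    CylindricRecurrence d fun a s => cylindricGenFun ![d - s, s] a := by
  refine ⟨fun s _ => cylindricGenFun_zero _, fun a s hs => ?_⟩
  have hsucc := cylindricGenFun_succ hs a
  rcases Nat.eq_zero_or_pos s with rfl | hs0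
  · rw [Set.union_eq_self_of_subset_right (secondRowMax_subset d _),
      normGenFun_firstRowMax hd] at hsucc
    rw [boundaryExtension_succ (show 1 ≤ d from hd)]
    simp only [boundaryExtension]
    linear_combination hsucc
  obtain ⟨s, rfl⟩ := Nat.exists_eq_add_one_of_ne_zero hs0.ne'
  rcases hs.eq_or_lt with rfl | hlt
  · rw [Set.union_eq_self_of_subset_left (firstRowMax_subset _ _),
      normGenFun_secondRowMax s.lt_succ_self] at hsucc
    rw [boundaryExtension_last, boundaryExtension_succ s.le_succ]
    linear_combination hsucc
  · have hie := normGenFun_union_add_inter (m := ![d - (s + 1), s + 1]) (a := a + 1)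
      (S := firstRowMax d (s + 1) (a + 1)) (T := secondRowMax d (s + 1) (a + 1))
      (fun _ h => h.1) (fun _ h => h.1)
    rw [← image_prependSecond_firstRowMax hs,
      normGenFun_image (prependSecond_injective _) (arrayNorm_prependSecond _),
      normGenFun_firstRowMax hs, normGenFun_firstRowMax hlt, normGenFun_secondRowMax hs] at hie
    rw [boundaryExtension_succ (show s ≤ d by omega),
      boundaryExtension_succ (show s + 2 ≤ d by omega)]
    linear_combination hsucc + hie

/-! ### Unrolling the transform into a sum over partitions -/

/-- The first part of a partition split off, together with the remaining parts. -/
def PartitionsAtMost.uncons {k : ℕ} (p : PartitionsAtMost (k + 1)) : ℕ × PartitionsAtMost k :=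
  (p.1 0, ⟨fun j => p.1 (j + 1), fun _ _ h => p.2.1 (Nat.add_le_add_right h 1),
    fun j hj => p.2.2 (j + 1) (Nat.add_le_add_right hj 1)⟩)

theorem PartitionsAtMost.uncons_injective (k : ℕ) :
    Function.Injective (PartitionsAtMost.uncons (k := k)) := by
  intro p p' h
  apply Subtype.ext
  funext j
  cases j with
  | zero => exact congrArg Prod.fst h
  | succ j => exact congrFun (congrArg (fun x => x.2.1) h) j

theorem PartitionsAtMost.exists_uncons_eq {k n : ℕ} {p : PartitionsAtMost k} (h : p.1 0 ≤ n) :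
    ∃ p' : PartitionsAtMost (k + 1), p'.uncons = (n, p) := by
  refine ⟨⟨fun j => Nat.casesOn j n p.1, antitone_nat_of_succ_le fun j => ?_, fun j hj => ?_⟩, rfl⟩
  · cases j with
    | zero => exact h
    | succ j => exact p.2.1 j.le_succ
  · obtain ⟨j, rfl⟩ := Nat.exists_eq_succ_of_ne_zero (show j ≠ 0 by omega)
    exact p.2.2 j (by omega)

/-- The reciprocal of
`(q;q)_{a-λ_1} (q;q)_{λ_1-λ_2} ⋯ (q;q)_{λ_{k-1}-λ_k} (q^f;q^f)_{λ_k}`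
for `λ_1 ≤ a`, built up part by part. For `k = 0` it is `1 / (q^f;q^f)_a`. -/
noncomputable def chainWeight (f : ℕ) : ℕ → ℕ → (ℕ → ℕ) → ℚ⟦X⟧
  | 0, a, _ => (pochhammerQ (X ^ f) (X ^ f) a)⁻¹
  | k + 1, a, p => (pochhammerQ X X (a - p 0))⁻¹ * chainWeight f k (p 0) fun j => p (j + 1)

theorem chainWeight_succ (f k a : ℕ) (p : ℕ → ℕ) :
    chainWeight f (k + 1) a p = (pochhammerQ X X (a - p 0) *
      (∏ j ∈ Finset.range k, pochhammerQ X X (p j - p (j + 1))) *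
        pochhammerQ (X ^ f) (X ^ f) (p k))⁻¹ := by
  induction k generalizing a p with
  | zero => simp [chainWeight, mul_comm]
  | succ k ih =>
    rw [chainWeight, ih, Finset.prod_range_succ']
    simp only [PowerSeries.mul_inv_rev]
    ring

/-- The summand of the multisum, divided by `(q^f;q^f)_a`. -/
noncomputable def chainTerm (f a i : ℕ) {k : ℕ} (p : PartitionsAtMost k) : ℚ⟦X⟧ :=
  if p.1 0 ≤ a then X ^ agbExponent i p * chainWeight f k a p.1 else 0

theorem finite_partitionsAtMost_le (k a : ℕ) : {p : PartitionsAtMost k | p.1 0 ≤ a}.Finite := by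
  have hinj : Function.Injective fun (p : PartitionsAtMost k) (j : Fin k) => p.1 j := by
    intro p p' h
    apply Subtype.ext
    funext j
    by_cases hj : j < k
    · exact congrFun h ⟨j, hj⟩
    · rw [p.2.2 j (by omega), p'.2.2 j (by omega)]
  refine Set.Finite.of_finite_image ((Set.finite_Iic fun _ : Fin k => a).subset ?_) hinj.injOn
  rintro _ ⟨p, hp, rfl⟩ j
  exact (p.2.1 (Nat.zero_le _)).trans hp

theorem support_chainTerm_subset (f a i k : ℕ) :
    (Function.support fun p : PartitionsAtMost k => chainTerm f a i p) ⊆ {p | p.1 0 ≤ a} := by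
  intro p hp
  by_contra h
  exact hp (if_neg h)

theorem agbSum_eq_mul_finsum_chainTerm (f a i k : ℕ) :
    agbSum f a i (k + 1) =
      pochhammerQ (X ^ f) (X ^ f) a * ∑ᶠ p : PartitionsAtMost (k + 1), chainTerm f a i p := by
  rw [agbSum, mul_finsum]
  refine finsum_congr fun p => ?_
  rw [qMultinomial, chainTerm]
  split_ifs
  · rw [chainWeight_succ, Nat.add_sub_cancel]
    ring
  · simp

theorem agbExponent_uncons (i : ℕ) {k : ℕ} (p : PartitionsAtMost (k + 1)) :
    agbExponent i p =
      p.1 0 ^ 2 + (if i = 0 then p.1 0 else 0) + agbExponent (i - 1) p.uncons.2 := by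
  have hsq := Finset.sum_range_succ' (fun j => p.1 j ^ 2) k
  rcases i with _ | i
  · have hlin := Finset.sum_range_succ' (fun j => p.1 j) k
    simp only [agbExponent, PartitionsAtMost.uncons, Nat.Ico_zero_eq_range, if_true, zero_tsub]
    omega
  · have hlin := Finset.sum_Ico_add' (fun j => p.1 j) i k 1
    simp only [agbExponent, PartitionsAtMost.uncons, Nat.succ_ne_zero, if_false,
      Nat.add_sub_cancel]
    omega

theorem finsum_chainTerm_succ (f a i k : ℕ) :
    ∑ᶠ p : PartitionsAtMost (k + 1), chainTerm f a i p =
      ∑ n ∈ Finset.range (a + 1), X ^ n ^ 2 * (pochhammerQ X X (a - n))⁻¹ *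
        (X ^ (if i = 0 then n else 0) *
          ∑ᶠ p : PartitionsAtMost k, chainTerm f n (i - 1) p) := by
  let F : ℕ × PartitionsAtMost k → ℚ⟦X⟧ := fun x =>
    if x.1 ≤ a then X ^ x.1 ^ 2 * (pochhammerQ X X (a - x.1))⁻¹ *
      (X ^ (if i = 0 then x.1 else 0) * chainTerm f x.1 (i - 1) x.2) else 0
  have hF : ∀ p : PartitionsAtMost (k + 1), chainTerm f a i p = F p.uncons := by
    intro p
    have h10 : p.uncons.2.1 0 ≤ p.uncons.1 := p.2.1 (Nat.zero_le 1)
    have hw : chainWeight f (k + 1) a p.1 = (pochhammerQ X X (a - p.uncons.1))⁻¹ *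
      chainWeight f k p.uncons.1 p.uncons.2.1 := rfl
    have he : agbExponent i p = p.uncons.1 ^ 2 + (if i = 0 then p.uncons.1 else 0) +
      agbExponent (i - 1) p.uncons.2 := agbExponent_uncons i p
    simp only [F, chainTerm, if_pos h10, hw, he, pow_add]
    refine if_congr Iff.rfl ?_ rfl
    ring
  have hsupp : Function.support F ⊆ Set.range (PartitionsAtMost.uncons (k := k)) := by
    rintro ⟨n, p⟩ hx
    refine PartitionsAtMost.exists_uncons_eq ?_
    by_contra h
    exact hx (by simp [F, chainTerm, h])
  have hfin : (Function.support F).Finite := by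
    refine ((finite_partitionsAtMost_le (k + 1) a).image PartitionsAtMost.uncons).subset ?_
    intro x hx
    obtain ⟨p, rfl⟩ := hsupp hx
    rw [Function.mem_support, ← hF] at hx
    exact ⟨p, support_chainTerm_subset f a i (k + 1) hx, rfl⟩
  have h1 : ∑ᶠ p : PartitionsAtMost (k + 1), chainTerm f a i p = ∑ᶠ x, F x := by
    rw [finsum_congr hF, ← finsum_mem_univ fun p : PartitionsAtMost (k + 1) => F p.uncons,
      ← finsum_mem_image (PartitionsAtMost.uncons_injective k).injOn, Set.image_univ,
      ← finsum_mem_inter_support, Set.inter_eq_right.2 hsupp, finsum_mem_support]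
  rw [h1, finsum_curry F hfin, finsum_eq_sum_of_support_subset (s := Finset.range (a + 1))]
  · refine Finset.sum_congr rfl fun n hn => ?_
    rw [mul_finsum, mul_finsum]
    exact finsum_congr fun p => if_pos (Nat.le_of_lt_succ (Finset.mem_range.1 hn))
  · intro n hn
    rw [Finset.mem_coe, Finset.mem_range]
    by_contra h
    refine hn ?_
    rw [← finsum_zero (α := PartitionsAtMost k)]
    exact finsum_congr fun p => if_neg (by simpa using h)

/-- Each solution at an initial level `d` whose rows are constantly `1 / (q^f;q^f)_n` propagates
to a solution at level `d + 2 k` whose values up to the middle of the row are multisums. -/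
theorem exists_cylindricRecurrence_multisum {d f : ℕ}
    (h : CylindricRecurrence d fun n _ => (pochhammerQ (X ^ f) (X ^ f) n)⁻¹) (k : ℕ) :
    ∃ g, CylindricRecurrence (d + 2 * k) g ∧
      ∀ a, ∀ i ≤ k, g a i = ∑ᶠ p : PartitionsAtMost k, chainTerm f a i p := by
  induction k with
  | zero =>
    refine ⟨_, h, fun a i hi => ?_⟩
    let p₀ : PartitionsAtMost 0 := ⟨fun _ => 0, fun _ _ _ => le_rfl, fun _ _ => rfl⟩
    have huniq : ∀ p : PartitionsAtMost 0, p = p₀ := fun p =>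
      Subtype.ext (funext fun j => p.2.2 j (Nat.zero_le j))
    rw [finsum_eq_single _ p₀ fun p hp => absurd (huniq p) hp]
    simp [chainTerm, chainWeight, agbExponent, p₀, Nat.le_zero.1 hi]
  | succ k ih =>
    obtain ⟨g, hg, hsum⟩ := ih
    refine ⟨_, hg.baileyTransform, fun a i hi => ?_⟩
    rw [finsum_chainTerm_succ]
    refine Finset.sum_congr rfl fun n _ => ?_
    congr 1
    cases i with
    | zero => simp [boundaryExtension, hsum n 0 (Nat.zero_le k)]
    | succ i =>
      simp [boundaryExtension, hsum n i (by omega), show i ≤ d + 2 * k by omega]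

theorem cylindricRecurrence_zero :
    CylindricRecurrence 0 fun n _ => (pochhammerQ (X ^ 2) (X ^ 2) n)⁻¹ := by
  refine ⟨fun s _ => by simp [pochhammerQ], fun n s hs => ?_⟩
  obtain rfl := Nat.le_zero.1 hs
  simp only [boundaryExtension, Nat.reduceLeDiff, if_false]
  linear_combination pochhammerQ_inv_succ two_ne_zero n

theorem cylindricRecurrence_one :
    CylindricRecurrence 1 fun n _ => (pochhammerQ (X ^ 1) (X ^ 1) n)⁻¹ := by
  refine ⟨fun s _ => by simp [pochhammerQ], fun n s hs => ?_⟩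
  have := pochhammerQ_inv_succ one_ne_zero n
  interval_cases s
  · simp only [boundaryExtension, le_refl, if_true]
    linear_combination this
  · simp only [boundaryExtension, Nat.zero_le, if_true, Nat.reduceLeDiff, if_false]
    linear_combination this

theorem cylindricGenFun_eq_agbSum {d₀ f k : ℕ} (hf : f ≠ 0)
    (h : CylindricRecurrence d₀ fun n _ => (pochhammerQ (X ^ f) (X ^ f) n)⁻¹) (hk : 0 < k)
    {i : ℕ} (hi : i ≤ k) (a : ℕ) :
    cylindricGenFun ![d₀ + 2 * k - i, i] a =
      (pochhammerQ (X ^ f) (X ^ f) a)⁻¹ * agbSum f a i k := by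
  obtain ⟨g, hg, hsum⟩ := exists_cylindricRecurrence_multisum h k
  rw [(cylindricRecurrence_cylindricGenFun (by omega)).unique hg a i (by omega), hsum a i hi]
  obtain ⟨k, rfl⟩ := Nat.exists_eq_succ_of_ne_zero hk.ne'
  rw [Nat.succ_eq_add_one, agbSum_eq_mul_finsum_chainTerm, ← mul_assoc, mul_comm (_)⁻¹,
    pochhammerQ_mul_inv hf, one_mul]

theorem mainTheorem1 (d k i a : ℕ) (hd : 2 ≤ d) (hk : k = d / 2) (hi : i ≤ k) :
    (Odd d →
      cylindricGenFun ![d - i, i] a = (pochhammerQ X X a)⁻¹ * agbSum 1 a i k) ∧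
    (Even d →
      cylindricGenFun ![d - i, i] a =
        (pochhammerQ (X ^ 2) (X ^ 2) a)⁻¹ * agbSum 2 a i k) := by
  refine ⟨fun hodd => ?_, fun heven => ?_⟩
  · obtain rfl : d = 1 + 2 * k := by
      obtain ⟨m, rfl⟩ := hodd
      omega
    simpa only [pow_one] using
      cylindricGenFun_eq_agbSum one_ne_zero cylindricRecurrence_one (by omega) hi a
  · obtain rfl : d = 0 + 2 * k := by
      obtain ⟨m, rfl⟩ := heven
      omega
    exact cylindricGenFun_eq_agbSum two_ne_zero cylindricRecurrence_zero (by omega) hi a
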